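/- Let $\xi$ be a probability measure on $\{0,1,2,\dots\}$ with $\sum_{k\ge 0}k\,\xi(k)\le 1$ and $\xi(1)<1$, and for every $k\ge 0$ let $\eta^{(k)}$ be a probability measure on $\{-1,0,1\}^k$ (for $k=0$, the point mass at the empty vector). Let $\mathbb T_0$ be the set of finite rooted plane trees $t$ with vertex labels $\ell_t\in\mathbb Z$ such that the root has label $0$ and labels change by $-1$, $0$ or $1$ along every edge. For a vertex $v$ of $t$ let $k_t(v)$ be its number of children and $[v]_t\in\{-1,0,1\}^{k_t(v)}$ the vector of label increments from $v$ to its children, from left to right. Then $$\Pi_0(t)=\prod_{v\in V(t)}\xi(k_t(v))\,\eta^{(k_t(v))}([v]_t),\qquad t\in\mathbb T_0,$$ defines a probability measure on $\mathbb T_0$. Let $T$ be a random tree with law $\Pi_0$, with edges oriented from parent to child. For $k\ge 1$ let $X_k^+$ (resp. $X_k^-$) be the number of edges of $T$ from a vertex labelled $k-1$ to one labelled $k$ (resp. from $k$ to $k-1$), and let $\check X_k^+$ (resp. $\check X_k^-$) be the number of edges of $T$ from a vertex labelled $-k$ to one labelled $-k+1$ (resp. from $-k+1$ to $-k$). Each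 of the two processes $(\check X_k^-,\check X_k^+)_{k\ge 1}$ and $(X_k^+,X_k^-)_{k\ge 1}$ is a time-homogeneous Markov chain on $\{0,1,2,\dots\}^2$. If the displacement laws are symmetric, i.e. for every $k$ the image of $\eta^{(k)}$ under $x\mapsto -x$ is $\eta^{(k)}$, then these two processes have the same law. Moreover, conditionally on the value of $(X_1^+,X_1^-)$, the two processes are independent. -/

import Mathlib

open MeasureTheory ProbabilityTheory
open scoped ENNReal

/-- Finite rooted plane trees whose edges carry an increment in `{-1, 0, 1}` (this is `SignType`).
`node k δ c` is the tree whose root has `k` children listed from left to right, the `i`-th edge from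
the root carrying the increment `δ i` and leading to the root of the subtree `c i`.

For every integer `x`, such a tree is the same thing as a plane tree with integer vertex labels
whose root has label `x` and whose labels change by `-1`, `0` or `1` along every edge: the label of a
vertex is `x` plus the sum of the increments along its ancestral line. -/
inductive LabelledPlaneTree : Type
  | node (k : ℕ) (δ : Fin k → SignType) (c : Fin k → LabelledPlaneTree) : LabelledPlaneTree

namespace LabelledPlaneTree

/-- Every set of trees is measurable (there are countably many trees). -/
instance : MeasurableSpace LabelledPlaneTree := ⊤

/-- `edgeCount a b x t` is the number of edges of `t`, oriented from parent to child, that go from a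
vertex labelled `a` to a vertex labelled `b`, when the root of `t` has label `x`. -/
def edgeCount (a b : ℤ) : ℤ → LabelledPlaneTree → ℕ
  | x, node _ δ c =>
    ∑ i, ((if x = a ∧ x + (δ i : ℤ) = b then 1 else 0) + edgeCount a b (x + (δ i : ℤ)) (c i))

/-- The weight `∏ ξ(k(v)) η^{(k(v))}([v])` of a labelled tree, the product being over all vertices `v`,
with `k(v)` the number of children of `v` and `[v]` the vector of label increments from `v` to its
children. -/
noncomputable def weight (ξ : PMF ℕ) (η : ∀ k : ℕ, PMF (Fin k → SignType)) :
    LabelledPlaneTree → ℝ≥0∞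
  | node k δ c => ξ k * η k δ * ∏ i, weight ξ η (c i)

/-- The law of the labelled Galton-Watson tree with offspring distribution `ξ` and displacement
distributions `η`: the measure giving mass `weight ξ η t` to every tree `t`. -/
noncomputable def law (ξ : PMF ℕ) (η : ∀ k : ℕ, PMF (Fin k → SignType)) :
    Measure LabelledPlaneTree :=
  Measure.sum fun t => weight ξ η t • Measure.dirac t

/-- `X_m⁺`: the number of edges from label `m - 1` to label `m`, the root having label `0`. -/
def Xplus (m : ℕ) (t : LabelledPlaneTree) : ℕ := edgeCount (m - 1) m 0 t

/-- `X_m⁻`: the number of edges from label `m` to label `m - 1`, the root having label `0`. -/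
def Xminus (m : ℕ) (t : LabelledPlaneTree) : ℕ := edgeCount m (m - 1) 0 t

/-- `X̌_m⁺`: the number of edges from label `-m` to label `-m + 1`, the root having label `0`. -/
def XcheckPlus (m : ℕ) (t : LabelledPlaneTree) : ℕ := edgeCount (-m) (-m + 1) 0 t

/-- `X̌_m⁻`: the number of edges from label `-m + 1` to label `-m`, the root having label `0`. -/
def XcheckMinus (m : ℕ) (t : LabelledPlaneTree) : ℕ := edgeCount (-m + 1) (-m) 0 t

/-- The process `(X_k⁺, X_k⁻)_{k ≥ 1}`; the entry of index `j : ℕ` is the one with `k = j + 1`. -/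
def posProcess (t : LabelledPlaneTree) (j : ℕ) : ℕ × ℕ := (Xplus (j + 1) t, Xminus (j + 1) t)

/-- The process `(X̌_k⁻, X̌_k⁺)_{k ≥ 1}` (in this order of the signs); the entry of index `j : ℕ` is
the one with `k = j + 1`. -/
def negProcess (t : LabelledPlaneTree) (j : ℕ) : ℕ × ℕ :=
  (XcheckMinus (j + 1) t, XcheckPlus (j + 1) t)

end LabelledPlaneTree

/-- A process `Y` with values in a countable discrete space `S` is a time-homogeneous Markov chain
under `μ`: there is one transition kernel `K`, the same at all times, such that
`μ(Y₀ = y₀, …, Yₙ₊₁ = yₙ₊₁) = μ(Y₀ = y₀, …, Yₙ = yₙ) K(yₙ, yₙ₊₁)`. -/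
def IsTimeHomogeneousMarkovChain {Ω S : Type*} [MeasurableSpace Ω] (μ : Measure Ω)
    (Y : Ω → ℕ → S) : Prop :=
  ∃ K : S → PMF S, ∀ (n : ℕ) (y : ℕ → S),
    μ {ω | ∀ i ≤ n + 1, Y ω i = y i} = μ {ω | ∀ i ≤ n, Y ω i = y i} * K (y n) (y (n + 1))

/-- The displacement laws are symmetric: if `D` has law `η k`, then so has `-D`. -/
def SymmetricDisplacements (η : ∀ k : ℕ, PMF (Fin k → SignType)) : Prop :=
  ∀ k : ℕ, (η k).map (fun δ i => -δ i) = η k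

/-! Take one formal variable for each edge type (parent label, increment). The coefficients of the
resulting tree generating function `edgeGf` are the probabilities of prescribed edge counts
(`law_edges`). Cut a tree with root label `x ≤ 0` at every edge between labels `0` and `1`. Labels
move by at most one, so a piece with labels `≤ 0` can be left only by the edge type `0 → 1`, and a
piece with labels `≥ 1` only by `1 → 0`. Let `f`, `h`, `g` be the series of the lower pieces rooted
at `0`, the lower pieces rooted at `x` and the upper pieces rooted at `1`, each counting exits. With
`p` and `q` the variables of the two crossing edges, the tree series is `h(V)`, where `V = p g(q
f(V))`.

Lagrange inversion in `p` shows that the coefficient of `p^n q^d` in `h(V)` is a product. One factor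
is `[z^d] g^n`, which involves only upper edges and does not depend on `x`. The other is `∑_{c+i=n}
(c/n) [v^c]h [v^i]f^d` (with `c/n` read as `1` at `n = 0`), which involves only lower edges. This is
`coeff_edgeGf`, and `law_edges_split` is its probabilistic form: given `(n, d)`, the lower and upper
edge counts are independent, and the upper law is independent of the root label.

With root label `0` this is the conditional independence. With root label `-n` the crossing pair is
the state at time `n`, the past lies below and the future above, so the positive process is Markov
with a kernel free of `n`. Reflecting labels transfers this to the negative process and gives
equality in law in the symmetric case. That the total mass is `1` is extinction of a (sub)critical
Galton-Watson tree. -/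

/-! ### Unconditional sums and formal substitution -/

/-- Commutative semirings in which arbitrary families can be summed. -/
class HasSums (R : Type) [CommSemiring R] where
  /-- The sum of a family. -/
  S : {ι : Type} → (ι → R) → R
  S_fintype : ∀ {ι : Type} [Fintype ι] (f : ι → R), S f = ∑ i, f i
  S_sigma : ∀ {ι : Type} {β : ι → Type} (f : (Σ i, β i) → R), S f = S fun i => S fun b => f ⟨i, b⟩
  S_equiv : ∀ {ι κ : Type} (e : ι ≃ κ) (f : κ → R), S (fun i => f (e i)) = S f
  mul_S : ∀ {ι : Type} (a : R) (f : ι → R), a * S f = S fun i => a * f i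

namespace HasSums

section Basic

variable {R : Type} [CommSemiring R] [HasSums R] {ι κ : Type}

theorem S_mul (a : R) (f : ι → R) : S f * a = S fun i => f i * a := by
  simp only [mul_comm _ a, mul_S]

theorem S_zero : S (fun _ : ι => (0 : R)) = 0 := by
  have := mul_S (0 : R) (fun _ : ι => (0 : R))
  simpa using this.symm

theorem S_prod (f : ι × κ → R) : S f = S fun i => S fun k => f (i, k) := by
  rw [← S_equiv (Equiv.sigmaEquivProd ι κ) f, S_sigma]
  rfl

theorem S_comm (f : ι → κ → R) : (S fun i => S fun k => f i k) = S fun k => S fun i => f i k := by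
  rw [← S_prod fun x : ι × κ => f x.1 x.2, ← S_prod fun x : κ × ι => f x.2 x.1,
    ← S_equiv (Equiv.prodComm κ ι)]
  rfl

theorem S_finset_sum (s : Finset κ) (f : ι → κ → R) :
    (S fun i => ∑ k ∈ s, f i k) = ∑ k ∈ s, S fun i => f i k := by
  have h (g : κ → R) : ∑ k ∈ s, g k = S fun k : s => g k := by
    rw [S_fintype, Finset.sum_coe_sort s g]
  simp only [h]
  exact S_comm _

theorem S_fiber (g : ι → κ) (f : ι → R) : S f = S fun k => S fun i : {i // g i = k} => f i := by
  rw [← S_equiv (Equiv.sigmaFiberEquiv g) f, S_sigma]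
  rfl

theorem S_unique [Unique ι] (f : ι → R) : S f = f default := by
  rw [S_fintype, Fintype.sum_unique]

theorem S_single [DecidableEq ι] (a : ι) (f : ι → R) (h : ∀ i, i ≠ a → f i = 0) : S f = f a := by
  rw [S_fiber (fun i => decide (i = a)) f, S_fintype, Fintype.sum_bool]
  have h1 : (S fun i : {i // decide (i = a) = true} => f i) = f a := by
    let : Unique {i // decide (i = a) = true} :=
      ⟨⟨⟨a, by simp⟩⟩, fun ⟨i, hi⟩ => by simpa using hi⟩
    exact S_unique _
  have h2 : (S fun i : {i // decide (i = a) = false} => f i) = 0 := by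
    rw [← S_zero (ι := {i // decide (i = a) = false})]
    congr 1
    funext i
    exact h i (by simpa using i.2)
  rw [h1, h2, add_zero]

theorem S_mul_S (f : ι → R) (g : κ → R) : S f * S g = S fun i => S fun k => f i * g k := by
  simp only [mul_S, S_mul]
  exact S_comm _

theorem prod_S {k : ℕ} (f : Fin k → ι → R) :
    ∏ i, S (f i) = S fun c : Fin k → ι => ∏ i, f i (c i) := by
  induction k with
  | zero => simp [S_unique]
  | succ k ih =>
    rw [Fin.prod_univ_succ, ih, S_mul_S, ← S_prod fun x : ι × (Fin k → ι) =>
      f 0 x.1 * ∏ i : Fin k, f i.succ (x.2 i),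
      ← S_equiv (Fin.consEquiv fun _ : Fin (k + 1) => ι)]
    congr 1
    funext x
    simp [Fin.prod_univ_succ, Fin.consEquiv]

theorem S_antidiagonal (f : ℕ → ℕ → R) :
    (S fun i => S fun j => f i j) = S fun n => ∑ x ∈ Finset.HasAntidiagonal.antidiagonal n, f x.1 x.2 := by
  rw [← S_prod fun x : ℕ × ℕ => f x.1 x.2,
    ← S_equiv Finset.HasAntidiagonal.sigmaAntidiagonalEquivProd, S_sigma]
  congr 1
  funext n
  rw [S_fintype, ← Finset.sum_coe_sort (Finset.HasAntidiagonal.antidiagonal n) fun x => f x.1 x.2]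
  rfl

end Basic

noncomputable instance : HasSums ℝ≥0∞ where
  S f := ∑' i, f i
  S_fintype f := tsum_fintype f
  S_sigma f := ENNReal.tsum_sigma' f
  S_equiv e f := e.tsum_eq f
  mul_S _ _ := ENNReal.tsum_mul_left.symm

theorem ennreal_S {ι : Type} (f : ι → ℝ≥0∞) : S f = ∑' i, f i := rfl

/-- The coefficientwise sum of a family of power series. -/
def mvPowerSeriesSum {σ R ι : Type} [CommSemiring R] [HasSums R] (f : ι → MvPowerSeries σ R) :
    MvPowerSeries σ R :=
  fun s => S fun i => MvPowerSeries.coeff s (f i)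

theorem coeff_mvPowerSeriesSum {σ R ι : Type} [CommSemiring R] [HasSums R]
    (f : ι → MvPowerSeries σ R) (s : σ →₀ ℕ) :
    MvPowerSeries.coeff s (mvPowerSeriesSum f) = S fun i => MvPowerSeries.coeff s (f i) := rfl

noncomputable instance mvPowerSeries (σ R : Type) [CommSemiring R] [HasSums R] :
    HasSums (MvPowerSeries σ R) where
  S f := mvPowerSeriesSum f
  S_fintype f := by
    ext s
    rw [map_sum]
    exact S_fintype _
  S_sigma f := by
    ext s
    exact S_sigma _
  S_equiv e f := by
    ext s
    exact S_equiv e fun i => MvPowerSeries.coeff s (f i)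
  mul_S a f := by
    classical
    ext s
    simp only [MvPowerSeries.coeff_mul, coeff_mvPowerSeriesSum, mul_S, S_finset_sum]

noncomputable instance powerSeries (R : Type) [CommSemiring R] [HasSums R] :
    HasSums (PowerSeries R) := mvPowerSeries Unit R

theorem mvPowerSeries_coeff_S {σ R ι : Type} [CommSemiring R] [HasSums R]
    (f : ι → MvPowerSeries σ R) (s : σ →₀ ℕ) :
    MvPowerSeries.coeff s (S f) = S fun i => MvPowerSeries.coeff s (f i) := rfl

theorem powerSeries_coeff_S {R ι : Type} [CommSemiring R] [HasSums R]
    (f : ι → PowerSeries R) (n : ℕ) :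
    PowerSeries.coeff n (S f) = S fun i => PowerSeries.coeff n (f i) := rfl

section Eval

variable {R R' : Type} [CommSemiring R] [CommSemiring R'] [HasSums R']

/-- The value at `y` of the power series `f`, with coefficients mapped through `ρ`. -/
noncomputable def ev (ρ : R →+* R') (y : R') (f : PowerSeries R) : R' :=
  S fun k => ρ (PowerSeries.coeff k f) * y ^ k

theorem ev_C (ρ : R →+* R') (y : R') (a : R) : ev ρ y (PowerSeries.C a) = ρ a := by
  rw [ev, S_single 0 _ fun k hk => by simp [PowerSeries.coeff_C, hk]]
  simp

/-- The Cauchy product may be regrouped because all sums exist; hence substitution is allowed even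
when `y` has a nonzero constant term. -/
theorem ev_mul (ρ : R →+* R') (y : R') (f g : PowerSeries R) :
    ev ρ y (f * g) = ev ρ y f * ev ρ y g := by
  simp only [ev, S_mul_S]
  rw [S_antidiagonal fun i j => ρ (PowerSeries.coeff i f) * y ^ i *
    (ρ (PowerSeries.coeff j g) * y ^ j)]
  congr 1
  funext n
  rw [PowerSeries.coeff_mul, map_sum, Finset.sum_mul]
  refine Finset.sum_congr rfl fun x hx => ?_
  rw [← Finset.HasAntidiagonal.mem_antidiagonal.1 hx, map_mul, pow_add]
  ring

theorem ev_pow (ρ : R →+* R') (y : R') (f : PowerSeries R) (n : ℕ) :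
    ev ρ y (f ^ n) = ev ρ y f ^ n := by
  induction n with
  | zero => rw [pow_zero, pow_zero, ← map_one PowerSeries.C, ev_C, map_one]
  | succ n ih => rw [pow_succ, pow_succ, ev_mul, ih]

theorem ev_S [HasSums R] {ι : Type} (y : R) (f : ι → PowerSeries R) :
    ev (RingHom.id R) y (S f) = S fun i => ev (RingHom.id R) y (f i) := by
  simp only [ev, powerSeries_coeff_S, RingHom.id_apply, S_mul]
  exact S_comm _

end Eval

end HasSums

open HasSums
open scoped NNReal

/-! ### Branching recursion for tree generating functions -/

namespace LabelledPlaneTree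

/-- A tree is the degree of its root, the increments below the root, and the subtrees. -/
def nodeEquiv : (Σ a : (Σ k : ℕ, Fin k → SignType), (Fin a.1 → LabelledPlaneTree)) ≃
    LabelledPlaneTree where
  toFun x := node x.1.1 x.1.2 x.2
  invFun := fun | node k δ c => ⟨⟨k, δ⟩, c⟩
  left_inv _ := rfl
  right_inv := fun | node _ _ _ => rfl

section Gf

variable {R : Type} [CommSemiring R]

/-- The branching property: once the root's degree and increments are fixed, the subtrees range
independently, so distributivity turns the sum into a product. -/
theorem S_tree [HasSums R] (K : ∀ k, (Fin k → SignType) → R)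
    (φ : ∀ k, (Fin k → SignType) → Fin k → LabelledPlaneTree → R)
    (F : LabelledPlaneTree → R) (hF : ∀ k δ c, F (node k δ c) = K k δ * ∏ i, φ k δ i (c i)) :
    S F = S fun a : (Σ k : ℕ, Fin k → SignType) => K a.1 a.2 * ∏ i, S (φ a.1 a.2 i) := by
  rw [← S_equiv nodeEquiv, S_sigma]
  congr 1
  funext a
  rw [prod_S, mul_S]
  congr 1
  funext c
  exact hF _ _ _

/-- The weight of a tree whose root has label `x`, when an edge from a vertex labelled `y` with
increment `ε` has weight `e y ε`, and a vertex labelled `y` weight `K y k δ`. -/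
def term (e : ℤ → SignType → R) (K : ℤ → ∀ k, (Fin k → SignType) → R) :
    ℤ → LabelledPlaneTree → R
  | x, node k δ c => K x k δ * ∏ i, (e x (δ i) * term e K (x + (δ i : ℤ)) (c i))

/-- The total weight of the trees whose root has label `x`. -/
noncomputable def gf [HasSums R] (e : ℤ → SignType → R) (K : ℤ → ∀ k, (Fin k → SignType) → R)
    (x : ℤ) : R :=
  S fun t => term e K x t

theorem gf_eq [HasSums R] (e : ℤ → SignType → R) (K : ℤ → ∀ k, (Fin k → SignType) → R) (x : ℤ) :
    gf e K x = S fun a : (Σ k : ℕ, Fin k → SignType) =>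
      K x a.1 a.2 * ∏ i, (e x (a.2 i) * gf e K (x + (a.2 i : ℤ))) := by
  rw [gf, S_tree (K x) (fun k δ i t => e x (δ i) * term e K (x + (δ i : ℤ)) t) _
    fun k δ c => by rw [term]]
  simp only [← mul_S]
  rfl

end Gf

end LabelledPlaneTree

/-! ### Agreement of power series up to a degree -/

namespace MvPowerSeries

variable {σ : Type}

/-- Two power series agree in degrees less than `N`. -/
def EqUpTo (N : ℕ) (a b : MvPowerSeries σ ℝ≥0∞) : Prop :=
  ∀ s : σ →₀ ℕ, s.degree < N → coeff s a = coeff s b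

namespace EqUpTo

variable {N : ℕ} {a b a' b' : MvPowerSeries σ ℝ≥0∞}

theorem eq (h : ∀ N, EqUpTo N a b) : a = b := by
  ext s
  exact h (s.degree + 1) s (Nat.lt_succ_self _)

theorem refl (a : MvPowerSeries σ ℝ≥0∞) : EqUpTo N a a := fun _ _ => rfl

theorem mul (h : EqUpTo N a b) (h' : EqUpTo N a' b') : EqUpTo N (a * a') (b * b') := by
  classical
  intro s hs
  rw [coeff_mul, coeff_mul]
  refine Finset.sum_congr rfl fun x hx => ?_
  have hd : x.1.degree + x.2.degree = s.degree := by
    rw [← map_add, Finset.HasAntidiagonal.mem_antidiagonal.1 hx]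
  rw [h _ (by omega), h' _ (by omega)]

/-- A factor `X i` gains one degree. This makes the fixed-point equations below contracting and
their solutions unique, with no subtraction needed. -/
theorem X_mul (i : σ) (h : EqUpTo N a b) : EqUpTo (N + 1) (X i * a) (X i * b) := by
  classical
  intro s hs
  rw [X, coeff_monomial_mul, coeff_monomial_mul]
  split_ifs with hle
  · congr 1
    refine h _ ?_
    have hd : (Finsupp.single i 1).degree + (s - Finsupp.single i 1).degree = s.degree := by
      rw [← map_add, add_tsub_cancel_of_le hle]
    rw [Finsupp.degree_single] at hd
    omega
  · rfl

theorem S {ι : Type} {f g : ι → MvPowerSeries σ ℝ≥0∞} (h : ∀ i, EqUpTo N (f i) (g i)) :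
    EqUpTo N (S f) (S g) := by
  intro s hs
  rw [mvPowerSeries_coeff_S, mvPowerSeries_coeff_S]
  congr 1
  funext i
  exact h i s hs

theorem prod {ι : Type} (t : Finset ι) {f g : ι → MvPowerSeries σ ℝ≥0∞}
    (h : ∀ i, EqUpTo N (f i) (g i)) : EqUpTo N (∏ i ∈ t, f i) (∏ i ∈ t, g i) := by
  classical
  induction t using Finset.induction_on with
  | empty => exact refl _
  | insert i t hi ih =>
    rw [Finset.prod_insert hi, Finset.prod_insert hi]
    exact (h i).mul ih

end EqUpTo

end MvPowerSeries

/-! ### Lagrange inversion -/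

/-- The factor `c / n`, with `n = c + i`, of the Lagrange inversion formula. -/
noncomputable def lagrangeFactor (c i : ℕ) : ℝ≥0 := if c + i = 0 then 1 else c / (c + i : ℕ)

/-- Compare coefficients in `(φ^(n+1))' = (n+1) φ^n φ'`. -/
theorem PowerSeries.sum_mul_coeff_mul_coeff_pow {R : Type} [CommSemiring R] (φ : PowerSeries R)
    (n N : ℕ) :
    (n + 1 : R) * ∑ x ∈ Finset.HasAntidiagonal.antidiagonal N,
      (x.1 : R) * (coeff x.1 φ * coeff x.2 (φ ^ n)) = N * coeff N (φ ^ (n + 1)) := by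
  cases N with
  | zero => simp
  | succ M =>
    have h := coeff_derivative (φ ^ (n + 1)) M
    rw [derivative_pow, Nat.add_sub_cancel, mul_assoc, mul_comm (φ ^ n), ← map_natCast (C (R := R)),
      coeff_C_mul, coeff_mul] at h
    rw [Finset.Nat.antidiagonal_succ, Finset.sum_cons, Finset.sum_map]
    simp only [Nat.cast_zero, zero_mul, zero_add]
    push_cast at h ⊢
    rw [mul_comm ((M : R) + 1), ← h]
    congr 1
    refine Finset.sum_congr rfl fun x _ => ?_
    simp only [coeff_derivative, Function.Embedding.prodMap, Function.Embedding.coeFn_mk,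
      Prod.map_fst, Prod.map_snd, Function.Embedding.refl_apply, Nat.succ_eq_add_one, Nat.cast_add,
      Nat.cast_one]
    ring

/-- With `n = c + N`, each factor is `(x.1 + c)/n`. The part with `c` is a Cauchy product, the part
with `x.1` comes from the derivative identity, and `(c + N/(n+1))/n = (c+1)/(n+1)`. -/
theorem sum_lagrangeFactor_mul {R : Type} [CommSemiring R] [Algebra ℝ≥0 R] (φ : PowerSeries R)
    (c N : ℕ) :
    ∑ x ∈ Finset.HasAntidiagonal.antidiagonal N, algebraMap ℝ≥0 R (lagrangeFactor (x.1 + c) x.2) *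
      (PowerSeries.coeff x.1 φ * PowerSeries.coeff x.2 (φ ^ (c + N))) =
    algebraMap ℝ≥0 R (lagrangeFactor (c + 1) N) * PowerSeries.coeff N (φ ^ (c + N + 1)) := by
  rcases Nat.eq_zero_or_pos (c + N) with h0 | hpos
  · obtain ⟨rfl, rfl⟩ : c = 0 ∧ N = 0 := by omega
    simp [lagrangeFactor]
  · set n := c + N with hn
    have hn0 : (n : ℝ≥0) ≠ 0 := by exact_mod_cast hpos.ne'
    have hn1 : (n : ℝ≥0) + 1 ≠ 0 := by positivity
    set Q := PowerSeries.coeff N (φ ^ (n + 1)) with hQ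
    have h1 : ∑ x ∈ Finset.HasAntidiagonal.antidiagonal N,
        PowerSeries.coeff x.1 φ * PowerSeries.coeff x.2 (φ ^ n) = Q := by
      rw [hQ, pow_succ', PowerSeries.coeff_mul]
    have h2 : ∑ x ∈ Finset.HasAntidiagonal.antidiagonal N,
        (x.1 : R) * (PowerSeries.coeff x.1 φ * PowerSeries.coeff x.2 (φ ^ n)) =
        algebraMap ℝ≥0 R (N / (n + 1)) * Q := by
      have := PowerSeries.sum_mul_coeff_mul_coeff_pow φ n N
      have h3 : algebraMap ℝ≥0 R ((n + 1 : ℝ≥0)⁻¹) * (n + 1 : R) = 1 := by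
        have : (n + 1 : R) = algebraMap ℝ≥0 R (n + 1) := by simp
        rw [this, ← map_mul, inv_mul_cancel₀ hn1, map_one]
      rw [div_eq_inv_mul, map_mul, mul_assoc, map_natCast, ← this, ← mul_assoc, h3, one_mul]
    have h4 : ∀ x ∈ Finset.HasAntidiagonal.antidiagonal N,
        algebraMap ℝ≥0 R (lagrangeFactor (x.1 + c) x.2) *
          (PowerSeries.coeff x.1 φ * PowerSeries.coeff x.2 (φ ^ n)) =
        algebraMap ℝ≥0 R (n : ℝ≥0)⁻¹ *
          ((x.1 : R) * (PowerSeries.coeff x.1 φ * PowerSeries.coeff x.2 (φ ^ n)) +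
          (c : R) * (PowerSeries.coeff x.1 φ * PowerSeries.coeff x.2 (φ ^ n))) := by
      intro x hx
      have hx' := Finset.HasAntidiagonal.mem_antidiagonal.1 hx
      have : x.1 + c + x.2 = n := by omega
      rw [lagrangeFactor, this, if_neg (by omega), div_eq_inv_mul, map_mul, map_natCast]
      push_cast
      ring
    rw [Finset.sum_congr rfl h4, ← Finset.mul_sum, Finset.sum_add_distrib, ← Finset.mul_sum, h1, h2,
      ← map_natCast (algebraMap ℝ≥0 R) c, ← add_mul, ← map_add, ← mul_assoc, ← map_mul]
    congr 2
    have h5 : c + 1 + N = n + 1 := by omega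
    rw [lagrangeFactor, h5, if_neg (by omega)]
    have h6 : (n : ℝ≥0) = c + N := by exact_mod_cast hn
    push_cast
    field_simp
    rw [h6]
    ring

/-- **Lagrange inversion**, for `V = X φ(V)`. -/
theorem MvPowerSeries.lagrange_inversion {σ : Type} (p : σ)
    (φ : PowerSeries (MvPowerSeries σ ℝ≥0∞)) (V : MvPowerSeries σ ℝ≥0∞)
    (hV : V = X p * ev (RingHom.id _) V φ) (c : ℕ) :
    V ^ c = S fun i : ℕ => algebraMap ℝ≥0 (MvPowerSeries σ ℝ≥0∞) (lagrangeFactor c i) *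
      (X p ^ (c + i) * PowerSeries.coeff i (φ ^ (c + i))) := by
  set W : ℕ → MvPowerSeries σ ℝ≥0∞ := fun c =>
    S fun i : ℕ => algebraMap ℝ≥0 (MvPowerSeries σ ℝ≥0∞) (lagrangeFactor c i) *
      (X p ^ (c + i) * PowerSeries.coeff i (φ ^ (c + i))) with hW
  have hW0 : W 0 = 1 := by
    rw [hW]
    simp only
    rw [S_single 0]
    · simp [lagrangeFactor]
    · intro i hi
      simp [lagrangeFactor, hi]
  -- The claimed expansions `W c` obey the same recursion in `c` as the powers `V ^ c`, which is `V
  -- = X φ(V)` times `V ^ c`.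
  have hWs (c : ℕ) : W (c + 1) = X p * S fun k => PowerSeries.coeff k φ * W (k + c) := by
    simp only [hW, mul_S]
    rw [S_antidiagonal fun k i => X p * (PowerSeries.coeff k φ *
      (algebraMap ℝ≥0 (MvPowerSeries σ ℝ≥0∞) (lagrangeFactor (k + c) i) *
      (X p ^ (k + c + i) * PowerSeries.coeff i (φ ^ (k + c + i)))))]
    congr 1
    funext N
    have h := sum_lagrangeFactor_mul φ c N
    have h1 : c + 1 + N = c + N + 1 := by omega
    rw [h1, mul_left_comm, ← h, Finset.mul_sum]
    refine Finset.sum_congr rfl fun x hx => ?_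
    have hx' := Finset.HasAntidiagonal.mem_antidiagonal.1 hx
    have h2 : x.1 + c + x.2 = c + N := by omega
    rw [h2, pow_succ]
    ring
  have hVs (c : ℕ) : V ^ (c + 1) = X p * S fun k => PowerSeries.coeff k φ * V ^ (k + c) := by
    rw [pow_succ']
    nth_rw 1 [hV]
    rw [mul_assoc, ev, S_mul]
    congr 2
    funext k
    rw [pow_add, RingHom.id_apply, mul_assoc]
  -- The recursion raises the exponent but carries a factor `X p`, so the induction is on the
  -- degree, for all `c` at once.
  have key (N : ℕ) : ∀ c, EqUpTo N (V ^ c) (W c) := by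
    induction N with
    | zero => exact fun c s hs => absurd hs (Nat.not_lt_zero _)
    | succ N ih =>
      intro c
      cases c with
      | zero => rw [pow_zero, hW0]; exact EqUpTo.refl _
      | succ c =>
        rw [hVs, hWs]
        exact EqUpTo.X_mul p (EqUpTo.S fun k => (EqUpTo.refl _).mul (ih _))
  exact EqUpTo.eq fun N => key N c

/-! ### Power series in a subset of the variables -/

namespace MvPowerSeries

variable {σ : Type}

/-- The power series in the variables from `P`. -/
def supportedIn (P : Set σ) : Subsemiring (MvPowerSeries σ ℝ≥0∞) where
  carrier := {f | ∀ s : σ →₀ ℕ, coeff s f ≠ 0 → ∀ i, s i ≠ 0 → i ∈ P}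
  mul_mem' {f g} hf hg s hs i hi := by
    classical
    rw [coeff_mul] at hs
    obtain ⟨x, hx, hne⟩ := Finset.exists_ne_zero_of_sum_ne_zero hs
    rw [← Finset.HasAntidiagonal.mem_antidiagonal.1 hx, Finsupp.add_apply] at hi
    rcases Nat.eq_zero_or_pos (x.1 i) with h | h
    · exact hg _ (right_ne_zero_of_mul hne) i (by omega)
    · exact hf _ (left_ne_zero_of_mul hne) i (by omega)
  one_mem' s hs i hi := by
    classical
    rw [coeff_one] at hs
    have : s = 0 := by by_contra h; simp [h] at hs
    simp [this] at hi
  add_mem' {f g} hf hg s hs i hi := by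
    rw [map_add] at hs
    by_cases h : coeff s f = 0
    · exact hg s (by simpa [h] using hs) i hi
    · exact hf s h i hi
  zero_mem' s hs := absurd (by simp) hs

theorem S_mem_supportedIn {P : Set σ} {ι : Type} {f : ι → MvPowerSeries σ ℝ≥0∞}
    (hf : ∀ i, f i ∈ supportedIn P) : S f ∈ supportedIn P := by
  intro s hs i hi
  rw [mvPowerSeries_coeff_S, ennreal_S, Ne, ENNReal.tsum_eq_zero, not_forall] at hs
  obtain ⟨k, hk⟩ := hs
  exact hf k s hk i hi

theorem monomial_mem_supportedIn {P : Set σ} {s : σ →₀ ℕ} (hs : ∀ i, s i ≠ 0 → i ∈ P)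
    (a : ℝ≥0∞) : monomial s a ∈ supportedIn P := by
  classical
  intro t ht i hi
  rw [coeff_monomial] at ht
  have : t = s := by by_contra h; simp [h] at ht
  exact hs i (this ▸ hi)

theorem C_mem_supportedIn (P : Set σ) (a : ℝ≥0∞) : C a ∈ supportedIn P :=
  monomial_mem_supportedIn (s := 0) (by simp) a

theorem X_mem_supportedIn {P : Set σ} {i : σ} (hi : i ∈ P) : X i ∈ supportedIn P := by
  classical
  refine monomial_mem_supportedIn (fun j hj => ?_) 1
  rw [Finsupp.single_apply] at hj
  by_cases h : i = j
  · exact h ▸ hi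
  · simp [h] at hj

/-- A monomial splits in only one way into a part in `P` and a part off `P`. -/
theorem coeff_mul_of_mem_supportedIn {P : Set σ} [DecidablePred (· ∈ P)]
    {f g : MvPowerSeries σ ℝ≥0∞} (hf : f ∈ supportedIn P) (hg : g ∈ supportedIn Pᶜ) (s : σ →₀ ℕ) :
    coeff s (f * g) = coeff (s.filter (· ∈ P)) f * coeff (s.filter (fun i => ¬ i ∈ P)) g := by
  classical
  rw [coeff_mul, Finset.sum_eq_single (s.filter (· ∈ P), s.filter (fun i => ¬ i ∈ P))]
  · rintro ⟨a, b⟩ hab hne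
    have hab' : a + b = s := Finset.HasAntidiagonal.mem_antidiagonal.1 hab
    by_contra h
    have ha : ∀ i, a i ≠ 0 → i ∈ P := hf a (left_ne_zero_of_mul h)
    have hb : ∀ i, b i ≠ 0 → i ∉ P := hg b (right_ne_zero_of_mul h)
    refine hne (Prod.ext ?_ ?_) <;> ext i <;> subst hab'
    · by_cases hi : i ∈ P
      · have : b i = 0 := by by_contra h'; exact hb i h' hi
        simp [hi, this]
      · have : a i = 0 := by by_contra h'; exact hi (ha i h')
        simp [hi, this]
    · by_cases hi : i ∈ P
      · have : b i = 0 := by by_contra h'; exact hb i h' hi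
        simp [hi, this]
      · have : a i = 0 := by by_contra h'; exact hi (ha i h')
        simp [hi, this]
  · intro h
    exact absurd (Finset.HasAntidiagonal.mem_antidiagonal.2 (Finsupp.filter_add_filter_not s _)) h

end MvPowerSeries

theorem PowerSeries.coeff_pow_mem {R : Type} [CommSemiring R] (Q : Subsemiring R)
    {g : PowerSeries R} (hg : ∀ d, coeff d g ∈ Q) (n d : ℕ) : coeff d (g ^ n) ∈ Q := by
  induction n generalizing d with
  | zero =>
    rw [pow_zero, coeff_one]
    split_ifs
    exacts [Q.one_mem, Q.zero_mem]
  | succ n ih =>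
    rw [pow_succ, coeff_mul]
    exact Q.sum_mem fun x _ => Q.mul_mem (ih _) (hg _)

/-! ### Cutting trees between labels 0 and 1 -/

namespace LabelledPlaneTree

/-- Power series with one variable for every type of edge: an edge type is given by the label of the
parent and the increment. -/
abbrev EdgeSeries : Type := MvPowerSeries (ℤ × SignType) ℝ≥0∞

open MvPowerSeries (X C)

variable (w : ∀ k, (Fin k → SignType) → ℝ≥0∞)

/-- The generating function of the trees by their edges, when the root has label `x` and `w` gives
the weights of the vertices. -/
noncomputable def edgeGf (x : ℤ) : EdgeSeries :=
  gf (fun y ε => X (y, ε)) (fun _ k δ => C (w k δ)) x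

theorem edgeGf_eq (x : ℤ) : edgeGf w x = S fun a : (Σ k : ℕ, Fin k → SignType) =>
    C (w a.1 a.2) * ∏ i, (X (x, a.2 i) * edgeGf w (x + (a.2 i : ℤ))) :=
  gf_eq _ _ _

/-- Uniqueness for the branching recursion, by induction on the degree: every child brings an edge
variable. The alternative lets the recursion be checked only on the labels inside a domain. -/
theorem eq_edgeGf (A : ℤ → EdgeSeries)
    (hA : ∀ x, A x = edgeGf w x ∨ A x = S fun a : (Σ k : ℕ, Fin k → SignType) =>
      C (w a.1 a.2) * ∏ i, (X (x, a.2 i) * A (x + (a.2 i : ℤ)))) (x : ℤ) :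
    A x = edgeGf w x := by
  have key (N : ℕ) : ∀ x, MvPowerSeries.EqUpTo N (A x) (edgeGf w x) := by
    induction N with
    | zero => exact fun _ s hs => absurd hs (Nat.not_lt_zero _)
    | succ N ih =>
      intro x
      rcases hA x with h | h
      · rw [h]
        exact .refl _
      rw [h, edgeGf_eq]
      exact .S fun a => (MvPowerSeries.EqUpTo.refl _).mul
        (.prod _ fun i => .X_mul _ (ih _))
  exact MvPowerSeries.EqUpTo.eq fun N => key N x

open scoped Classical in
/-- The number of edges of a tree that lead from a label in `D` to a label outside. -/
noncomputable def exitCount (D : Set ℤ) : ℤ → LabelledPlaneTree → ℕ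
  | x, node _ δ c => ∑ i, ((if x ∈ D ∧ x + (δ i : ℤ) ∉ D then 1 else 0) +
      exitCount D (x + (δ i : ℤ)) (c i))

open scoped Classical in
/-- The variable of an edge if both its ends have labels in `D`, and `1` otherwise. -/
noncomputable def innerVar (D : Set ℤ) (x : ℤ) (ε : SignType) : EdgeSeries :=
  if x ∈ D ∧ x + (ε : ℤ) ∈ D then X (x, ε) else 1

open scoped Classical in
/-- The weights of vertices for trees whose vertices with labels outside `D` are leaves. -/
noncomputable def killedWeight (D : Set ℤ) (x : ℤ) (k : ℕ) (δ : Fin k → SignType) : EdgeSeries :=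
  if x ∈ D then C (w k δ) else if k = 0 then 1 else 0

open scoped Classical in
theorem term_exit {D : Set ℤ} (K : ℤ → ∀ k, (Fin k → SignType) → EdgeSeries) (Y : EdgeSeries)
    (t : LabelledPlaneTree) (x : ℤ) :
    term (fun y ε => if y ∈ D ∧ y + (ε : ℤ) ∉ D then Y else innerVar D y ε) K x t =
      term (innerVar D) K x t * Y ^ exitCount D x t := by
  induction t generalizing x with
  | node k δ c ih =>
    rw [term, term, exitCount, mul_assoc, ← Finset.prod_pow_eq_pow_sum, ← Finset.prod_mul_distrib]
    congr 1
    refine Finset.prod_congr rfl fun i _ => ?_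
    rw [ih, pow_add]
    by_cases h : x ∈ D ∧ x + (δ i : ℤ) ∉ D
    · have h' : innerVar D x (δ i) = 1 := by
        rw [innerVar, if_neg fun h'' => h.2 h''.2]
      rw [if_pos h, if_pos h, h']
      ring
    · rw [if_neg h, if_neg h]
      ring

/-- The generating function of the pieces of trees with labels in `D`, cut at the first edges that
lead out of `D`. The variable of the power series counts these edges. -/
noncomputable def pieceSeries (D : Set ℤ) (x : ℤ) : PowerSeries EdgeSeries :=
  PowerSeries.mk fun j => S fun t : {t // exitCount D x t = j} =>
    term (innerVar D) (killedWeight w D) x t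

open scoped Classical in
theorem ev_pieceSeries (D : Set ℤ) (x : ℤ) (Y : EdgeSeries) :
    ev (RingHom.id _) Y (pieceSeries w D x) =
      gf (fun y ε => if y ∈ D ∧ y + (ε : ℤ) ∉ D then Y else innerVar D y ε)
        (killedWeight w D) x := by
  rw [gf, S_fiber (exitCount D x), ev]
  congr 1
  funext j
  rw [RingHom.id_apply, pieceSeries, PowerSeries.coeff_mk, S_mul]
  congr 1
  funext t
  rw [term_exit, t.2]

theorem gf_killedWeight_of_notMem {D : Set ℤ} (e : ℤ → SignType → EdgeSeries) {x : ℤ} (hx : x ∉ D) :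
    gf e (killedWeight w D) x = 1 := by
  classical
  rw [gf_eq, S_single ⟨0, Fin.elim0⟩]
  · simp [killedWeight, hx]
  · rintro ⟨k, δ⟩ hne
    have hk : k ≠ 0 := by
      rintro rfl
      exact hne (by congr; exact Subsingleton.elim _ _)
    simp [killedWeight, hx, hk]

/-- A tree is a piece with trees grafted on the edges that lead out of `D`. -/
theorem edgeGf_eq_ev_pieceSeries {D : Set ℤ} {Y : EdgeSeries}
    (hY : ∀ x ∈ D, ∀ ε : SignType, x + (ε : ℤ) ∉ D → X (x, ε) * edgeGf w (x + (ε : ℤ)) = Y)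
    {x : ℤ} (hx : x ∈ D) : edgeGf w x = ev (RingHom.id _) Y (pieceSeries w D x) := by
  classical
  set e : ℤ → SignType → EdgeSeries :=
    fun y ε => if y ∈ D ∧ y + (ε : ℤ) ∉ D then Y else innerVar D y ε with he
  -- Grafting as a system of series: killed trees inside `D`, full trees outside. By `hY` an exit
  -- edge with its full tree contributes `Y`.
  set A : ℤ → EdgeSeries := fun y => if y ∈ D then gf e (killedWeight w D) y else edgeGf w y with hA
  rw [ev_pieceSeries, ← eq_edgeGf w A ?_ x]
  · simp only [hA, if_pos hx]
    rfl
  intro y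
  by_cases hy : y ∈ D
  · right
    have : A y = gf e (killedWeight w D) y := if_pos hy
    rw [this, gf_eq]
    congr 1
    funext a
    rw [killedWeight, if_pos hy]
    congr 1
    refine Finset.prod_congr rfl fun i _ => ?_
    by_cases hz : y + (a.2 i : ℤ) ∈ D
    · have h1 : A (y + (a.2 i : ℤ)) = gf e (killedWeight w D) (y + (a.2 i : ℤ)) := if_pos hz
      rw [h1]
      simp [he, innerVar, hy, hz]
    · have h1 : A (y + (a.2 i : ℤ)) = edgeGf w (y + (a.2 i : ℤ)) := if_neg hz
      rw [h1, hY y hy _ hz, gf_killedWeight_of_notMem w e hz]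
      simp [he, hy, hz]
  · exact Or.inl (if_neg hy)

theorem term_killedWeight_mem (D : Set ℤ) (t : LabelledPlaneTree) (x : ℤ) :
    term (innerVar D) (killedWeight w D) x t ∈
      MvPowerSeries.supportedIn {e : ℤ × SignType | e.1 ∈ D ∧ e.1 + (e.2 : ℤ) ∈ D} := by
  classical
  induction t generalizing x with
  | node k δ c ih =>
    rw [term]
    refine Subsemiring.mul_mem _ ?_ (Subsemiring.prod_mem _ fun i _ =>
      Subsemiring.mul_mem _ ?_ (ih _ _))
    · rw [killedWeight]
      split_ifs
      exacts [MvPowerSeries.C_mem_supportedIn _ _, Subsemiring.one_mem _, Subsemiring.zero_mem _]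
    · rw [innerVar]
      split_ifs with h
      exacts [MvPowerSeries.X_mem_supportedIn h, Subsemiring.one_mem _]

theorem coeff_pieceSeries_mem (D : Set ℤ) (x : ℤ) (j : ℕ) :
    PowerSeries.coeff j (pieceSeries w D x) ∈
      MvPowerSeries.supportedIn {e : ℤ × SignType | e.1 ∈ D ∧ e.1 + (e.2 : ℤ) ∈ D} := by
  rw [pieceSeries, PowerSeries.coeff_mk]
  exact MvPowerSeries.S_mem_supportedIn fun t => term_killedWeight_mem w D t x

/-- The series of the pieces of trees with labels at most `0`. -/
noncomputable abbrev lowerSeries (x : ℤ) : PowerSeries EdgeSeries := pieceSeries w (Set.Iic 0) x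

/-- The series of the pieces of trees with labels at least `1`. -/
noncomputable abbrev upperSeries : PowerSeries EdgeSeries := pieceSeries w (Set.Ici 1) 1

/-- The contribution of the lower pieces to the generating function, when there are `n` edges from
`0` to `1` and `d` edges from `1` to `0`. -/
noncomputable def lowerPart (x : ℤ) (n d : ℕ) : EdgeSeries :=
  ∑ y ∈ Finset.HasAntidiagonal.antidiagonal n, PowerSeries.coeff y.1 (lowerSeries w x) *
    (algebraMap ℝ≥0 EdgeSeries (lagrangeFactor y.1 y.2) *
      PowerSeries.coeff y.2 (lowerSeries w 0 ^ d))

/-- The contribution of the upper pieces to the generating function, when there are `n` edges from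
`0` to `1` and `d` edges from `1` to `0`. -/
noncomputable def upperPart (n d : ℕ) : EdgeSeries := PowerSeries.coeff d (upperSeries w ^ n)

/-- The edge from `0` to `1`. -/
def upEdge : ℤ × SignType := (0, 1)

/-- The edge from `1` to `0`. -/
def downEdge : ℤ × SignType := (1, -1)

theorem edgeGf_one : edgeGf w 1 = ev (RingHom.id _) (X downEdge * edgeGf w 0) (upperSeries w) := by
  refine edgeGf_eq_ev_pieceSeries w (fun x hx ε hε => ?_) (Set.mem_Ici.2 le_rfl)
  rw [Set.mem_Ici] at hx hε
  obtain ⟨rfl, rfl⟩ : x = 1 ∧ ε = -1 := by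
    cases ε <;> simp at hε ⊢ <;> omega
  rfl

theorem edgeGf_of_nonpos {x : ℤ} (hx : x ≤ 0) :
    edgeGf w x = ev (RingHom.id _) (X upEdge * edgeGf w 1) (lowerSeries w x) := by
  refine edgeGf_eq_ev_pieceSeries w (fun x hx ε hε => ?_) hx
  rw [Set.mem_Iic] at hx hε
  obtain ⟨rfl, rfl⟩ : x = 0 ∧ ε = 1 := by
    cases ε <;> simp at hε ⊢ <;> omega
  rfl

/-- The factorization, from Lagrange inversion for `V`, the series of an up-crossing with the tree
above it. Since `φ^n` is `g^n` evaluated at `q f`, the index `d` separates `[z^d] g^n` from `f^d`.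
-/
theorem edgeGf_eq_S {x : ℤ} (hx : x ≤ 0) :
    edgeGf w x = S fun n => S fun d =>
      lowerPart w x n d * (upperPart w n d * (X upEdge ^ n * X downEdge ^ d)) := by
  set V : EdgeSeries := X upEdge * edgeGf w 1 with hV
  set f := lowerSeries w 0 with hf
  set Y : PowerSeries EdgeSeries := PowerSeries.C (X downEdge) * f with hY
  set φ : PowerSeries EdgeSeries := ev PowerSeries.C Y (upperSeries w) with hφ
  have hVφ : V = X upEdge * ev (RingHom.id _) V φ := by
    conv_lhs => rw [hV, edgeGf_one, edgeGf_of_nonpos w le_rfl]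
    have h : ev (RingHom.id _) V φ = S fun k => ev (RingHom.id _) V
        (PowerSeries.C (PowerSeries.coeff k (upperSeries w)) * Y ^ k) := by
      rw [hφ]
      exact ev_S V _
    rw [h]
    simp only [ev_mul, ev_C, ev_pow, hY]
    rfl
  have hpow (n i : ℕ) : PowerSeries.coeff i (φ ^ n) =
      S fun d => upperPart w n d * (X downEdge ^ d * PowerSeries.coeff i (f ^ d)) := by
    rw [hφ, ← ev_pow, ev, powerSeries_coeff_S]
    congr 1
    funext d
    rw [PowerSeries.coeff_C_mul, hY, mul_pow, ← map_pow, PowerSeries.coeff_C_mul, upperPart]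
  rw [edgeGf_of_nonpos w hx, ev, ← hV]
  simp only [MvPowerSeries.lagrange_inversion upEdge φ V hVφ, mul_S, RingHom.id_apply]
  rw [S_antidiagonal fun c i => PowerSeries.coeff c (lowerSeries w x) *
    (algebraMap ℝ≥0 EdgeSeries (lagrangeFactor c i) *
      (X upEdge ^ (c + i) * PowerSeries.coeff i (φ ^ (c + i))))]
  congr 1
  funext n
  simp only [lowerPart, Finset.sum_mul, S_finset_sum]
  refine Finset.sum_congr rfl fun y hy => ?_
  rw [Finset.HasAntidiagonal.mem_antidiagonal.1 hy, hpow]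
  simp only [mul_S]
  congr 1
  funext d
  ring

/-- The edges between labels at most `0`. -/
def lowerEdges : Set (ℤ × SignType) := {e | e.1 ≤ 0 ∧ e.1 + (e.2 : ℤ) ≤ 0}

/-- The edges between labels at least `1`. -/
def upperEdges : Set (ℤ × SignType) := {e | 1 ≤ e.1 ∧ 1 ≤ e.1 + (e.2 : ℤ)}

theorem eq_upEdge_or_eq_downEdge {e : ℤ × SignType} (h : e ∉ lowerEdges) (h' : e ∉ upperEdges) :
    e = upEdge ∨ e = downEdge := by
  obtain ⟨x, ε⟩ := e
  simp only [lowerEdges, upperEdges, Set.mem_ofPred_eq, upEdge, downEdge, Prod.mk.injEq] at *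
  cases ε <;> simp at * <;> omega

theorem upEdge_notMem_lowerEdges : upEdge ∉ lowerEdges := by simp [upEdge, lowerEdges]

theorem downEdge_notMem_lowerEdges : downEdge ∉ lowerEdges := by simp [downEdge, lowerEdges]

theorem upEdge_notMem_upperEdges : upEdge ∉ upperEdges := by simp [upEdge, upperEdges]

theorem downEdge_notMem_upperEdges : downEdge ∉ upperEdges := by simp [downEdge, upperEdges]

theorem upperEdges_subset : upperEdges ⊆ lowerEdgesᶜ := by
  rintro ⟨x, ε⟩ ⟨h, -⟩ ⟨h', -⟩
  simp only at h h'
  omega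

theorem lowerPart_mem (x : ℤ) (n d : ℕ) :
    lowerPart w x n d ∈ MvPowerSeries.supportedIn lowerEdges := by
  refine Subsemiring.sum_mem _ fun y _ => Subsemiring.mul_mem _ (coeff_pieceSeries_mem _ _ _ _)
    (Subsemiring.mul_mem _ ?_ (PowerSeries.coeff_pow_mem _ (coeff_pieceSeries_mem _ _ _) _ _))
  exact MvPowerSeries.C_mem_supportedIn _ _

theorem upperPart_mem (n d : ℕ) : upperPart w n d ∈ MvPowerSeries.supportedIn upperEdges :=
  PowerSeries.coeff_pow_mem _ (coeff_pieceSeries_mem _ _ _) _ _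

theorem supportedIn_mono {σ : Type} {P Q : Set σ} (h : P ⊆ Q) {f : MvPowerSeries σ ℝ≥0∞}
    (hf : f ∈ MvPowerSeries.supportedIn P) : f ∈ MvPowerSeries.supportedIn Q :=
  fun s hs i hi => h (hf s hs i hi)

open scoped Classical in
/-- The weight of the trees with given numbers of edges factorizes. -/
theorem coeff_edgeGf {x : ℤ} (hx : x ≤ 0) (s : ℤ × SignType →₀ ℕ) :
    MvPowerSeries.coeff s (edgeGf w x) =
      MvPowerSeries.coeff (s.filter (· ∈ lowerEdges))
        (lowerPart w x (s upEdge) (s downEdge)) *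
      MvPowerSeries.coeff (s.filter (· ∈ upperEdges))
        (upperPart w (s upEdge) (s downEdge)) := by
  have hne : upEdge ≠ downEdge := by simp [upEdge, downEdge]
  have hterm (n d : ℕ) : MvPowerSeries.coeff s
      (lowerPart w x n d * (upperPart w n d * (X upEdge ^ n * X downEdge ^ d))) =
      if n = s upEdge ∧ d = s downEdge then
        MvPowerSeries.coeff (s.filter (· ∈ lowerEdges)) (lowerPart w x n d) *
        MvPowerSeries.coeff (s.filter (· ∈ upperEdges)) (upperPart w n d) else 0 := by
    have hX : (X upEdge ^ n * X downEdge ^ d : EdgeSeries) =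
        MvPowerSeries.monomial (Finsupp.single upEdge n + Finsupp.single downEdge d) 1 := by
      rw [MvPowerSeries.X_pow_eq, MvPowerSeries.X_pow_eq, MvPowerSeries.monomial_mul_monomial,
        one_mul]
    have hmem {P : Set (ℤ × SignType)} (h1 : upEdge ∉ P) (h2 : downEdge ∉ P) :
        (X upEdge ^ n * X downEdge ^ d : EdgeSeries) ∈ MvPowerSeries.supportedIn Pᶜ :=
      Subsemiring.mul_mem _ (Subsemiring.pow_mem _ (MvPowerSeries.X_mem_supportedIn h1) _)
        (Subsemiring.pow_mem _ (MvPowerSeries.X_mem_supportedIn h2) _)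
    rw [MvPowerSeries.coeff_mul_of_mem_supportedIn (lowerPart_mem w x n d)
        (Subsemiring.mul_mem _ (supportedIn_mono upperEdges_subset (upperPart_mem w n d))
          (hmem upEdge_notMem_lowerEdges downEdge_notMem_lowerEdges)),
      MvPowerSeries.coeff_mul_of_mem_supportedIn (upperPart_mem w n d)
        (hmem upEdge_notMem_upperEdges downEdge_notMem_upperEdges),
      hX, MvPowerSeries.coeff_monomial]
    have h1 : (s.filter (fun i => ¬ i ∈ lowerEdges)).filter (· ∈ upperEdges) =
        s.filter (· ∈ upperEdges) := by
      ext e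
      by_cases he : e ∈ upperEdges
      · have : e ∉ lowerEdges := upperEdges_subset he
        simp [he, this]
      · simp [he]
    -- Only the two crossing edge types are neither lower nor upper, so `s` determines `n` and `d`.
    have h2 : (s.filter (fun i => ¬ i ∈ lowerEdges)).filter (fun i => ¬ i ∈ upperEdges) =
        Finsupp.single upEdge n + Finsupp.single downEdge d ↔
        n = s upEdge ∧ d = s downEdge := by
      constructor
      · intro h
        have hu := DFunLike.congr_fun h upEdge
        have hd := DFunLike.congr_fun h downEdge
        simp [upEdge_notMem_lowerEdges, downEdge_notMem_lowerEdges, upEdge_notMem_upperEdges,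
          downEdge_notMem_upperEdges, hne] at hu hd
        exact ⟨hu.symm, hd.symm⟩
      · rintro ⟨rfl, rfl⟩
        ext e
        by_cases he : e ∈ lowerEdges
        · have h1 : upEdge ≠ e := fun h => upEdge_notMem_lowerEdges (h ▸ he)
          have h2 : downEdge ≠ e := fun h => downEdge_notMem_lowerEdges (h ▸ he)
          simp [he, h1, h2, Finsupp.filter_apply]
        by_cases he' : e ∈ upperEdges
        · have h1 : upEdge ≠ e := fun h => upEdge_notMem_upperEdges (h ▸ he')
          have h2 : downEdge ≠ e := fun h => downEdge_notMem_upperEdges (h ▸ he')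
          simp [he', h1, h2]
        rcases eq_upEdge_or_eq_downEdge he he' with rfl | rfl
        · simp [he, he', hne]
        · simp [he, he', hne.symm]
    rw [h1]
    simp only [h2]
    split_ifs
    · rw [mul_one]
    · rw [mul_zero, mul_zero]
  rw [edgeGf_eq_S w hx, mvPowerSeries_coeff_S]
  simp only [mvPowerSeries_coeff_S, hterm]
  rw [S_single (s upEdge)]
  · rw [S_single (s downEdge)]
    · simp
    · intro d hd
      simp [hd]
  · intro n hn
    simp [hn, S_zero]

end LabelledPlaneTree

/-! ### Extinction: the total mass is one -/

namespace LabelledPlaneTree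

section Extinction

variable (ξ : PMF ℕ) (η : ∀ k : ℕ, PMF (Fin k → SignType))

theorem law_apply (A : Set LabelledPlaneTree) :
    law ξ η A = ∑' t, A.indicator (weight ξ η) t := by
  rw [law, Measure.sum_apply _ MeasurableSpace.measurableSet_top]
  congr 1
  funext t
  rw [Measure.smul_apply, Measure.dirac_apply' _ MeasurableSpace.measurableSet_top, smul_eq_mul]
  by_cases h : t ∈ A <;> simp [h]

/-- Separate `F` and `G` cover both the truncated weights, where the height bound drops, and the
fixed-point equation of the total mass. -/
theorem tsum_tree (F G : LabelledPlaneTree → ℝ≥0∞)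
    (hF : ∀ k δ c, F (node k δ c) = ξ k * η k δ * ∏ i, G (c i)) :
    ∑' t, F t = ∑' k, ξ k * (∑' t, G t) ^ k := by
  rw [← ennreal_S, S_tree (fun k δ => ξ k * η k δ) (fun _ _ _ => G) F hF, S_sigma]
  congr 1
  funext k
  simp only [Finset.prod_const, Finset.card_univ, Fintype.card_fin, ← S_mul, ← mul_S]
  rw [ennreal_S, (η k).tsum_coe, mul_one, ennreal_S]

/-- The weight of a tree, or `0` if the height is at least `h`. -/
noncomputable def truncatedWeight : ℕ → LabelledPlaneTree → ℝ≥0∞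
  | 0, _ => 0
  | h + 1, node k δ c => ξ k * η k δ * ∏ i, truncatedWeight h (c i)

theorem tsum_truncatedWeight_le_one (h : ℕ) : ∑' t, truncatedWeight ξ η h t ≤ 1 := by
  induction h with
  | zero => simp [truncatedWeight]
  | succ h ih =>
    rw [tsum_tree ξ η _ (truncatedWeight ξ η h) fun k δ c => by rw [truncatedWeight]]
    calc ∑' k, ξ k * (∑' t, truncatedWeight ξ η h t) ^ k ≤ ∑' k, ξ k :=
          ENNReal.tsum_le_tsum fun k => mul_le_of_le_one_right' (pow_le_one' ih k)
      _ = 1 := ξ.tsum_coe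

theorem eventually_truncatedWeight_eq (t : LabelledPlaneTree) :
    ∀ᶠ h in Filter.atTop, truncatedWeight ξ η h t = weight ξ η t := by
  induction t with
  | node k δ c ih =>
    have h1 := (Filter.tendsto_sub_atTop_nat 1).eventually (Filter.eventually_all.2 ih)
    filter_upwards [h1, Filter.eventually_ge_atTop 1] with h hh hpos
    obtain ⟨h, rfl⟩ := Nat.exists_eq_add_of_le' hpos
    rw [truncatedWeight, weight]
    congr 1
    exact Finset.prod_congr rfl fun i _ => hh i

/-- On a finite set of trees the weight agrees with the truncated one for large heights. This bound
is needed because the fixed-point equation alone does not exclude masses above `1`. -/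
theorem tsum_weight_le_one : ∑' t, weight ξ η t ≤ 1 := by
  rw [ENNReal.tsum_eq_iSup_sum]
  refine iSup_le fun F => ?_
  have h1 := (Filter.eventually_all_finset F).2 fun t _ => eventually_truncatedWeight_eq ξ η t
  obtain ⟨h, hh⟩ := h1.exists
  calc ∑ t ∈ F, weight ξ η t = ∑ t ∈ F, truncatedWeight ξ η h t :=
        Finset.sum_congr rfl fun t ht => (hh t ht).symm
    _ ≤ ∑' t, truncatedWeight ξ η h t := ENNReal.sum_le_tsum F
    _ ≤ 1 := tsum_truncatedWeight_le_one ξ η h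

end Extinction

theorem _root_.one_sub_mul_one_sub_lt_pow {q : ℝ} (hq0 : 0 ≤ q) (hq1 : q < 1) {k : ℕ} (hk : 2 ≤ k) :
    1 - k * (1 - q) < q ^ k := by
  obtain ⟨j, rfl⟩ := Nat.exists_eq_add_of_le' hk
  have h := one_add_mul_le_pow (a := q - 1) (by linarith) (j + 1)
  rw [show j + 2 = j + 1 + 1 by omega, pow_succ]
  rw [add_sub_cancel] at h
  push_cast at h ⊢
  have h2 := mul_le_mul_of_nonneg_right h hq0
  have hj : (0 : ℝ) ≤ j := j.cast_nonneg
  nlinarith [mul_nonneg hj (sq_nonneg (1 - q)), sq_pos_of_pos (sub_pos.2 hq1)]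

/-- The generating function of a critical or subcritical offspring law has no fixed point below
`1`. -/
theorem _root_.PMF.eq_one_of_tsum_mul_pow_eq (ξ : PMF ℕ)
    (hmean : ∑' k : ℕ, ξ k * (k : ℝ≥0∞) ≤ 1) (hξ : ξ 1 ≠ 1) {Q : ℝ≥0∞} (hQ1 : Q ≤ 1)
    (hQ : Q = ∑' k, ξ k * Q ^ k) : Q = 1 := by
  by_contra hne
  have hQt : Q ≠ ∞ := ne_top_of_le_ne_top ENNReal.one_ne_top hQ1
  set q := Q.toReal with hq
  have hq0 : 0 ≤ q := ENNReal.toReal_nonneg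
  have hq1 : q < 1 := by
    rw [hq, ← ENNReal.toReal_one]
    exact (ENNReal.toReal_lt_toReal hQt ENNReal.one_ne_top).2 (lt_of_le_of_ne hQ1 hne)
  have toReal {f : ℕ → ℝ≥0∞} (hf : ∑' k, f k ≤ 1) :
      HasSum (fun k => (f k).toReal) (∑' k, f k).toReal := by
    have hne : ∑' k, f k ≠ ∞ := ne_top_of_le_ne_top ENNReal.one_ne_top hf
    rw [ENNReal.tsum_toReal_eq fun k => ENNReal.ne_top_of_tsum_ne_top hne k]
    exact (ENNReal.summable_toReal hne).hasSum
  set x : ℕ → ℝ := fun k => (ξ k).toReal with hx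
  have hx0 (k : ℕ) : 0 ≤ x k := ENNReal.toReal_nonneg
  have h1 : HasSum x 1 := by simpa [ξ.tsum_coe] using toReal ξ.tsum_coe.le
  have h2 : HasSum (fun k => x k * q ^ k) q := by
    have := toReal (hQ ▸ hQ1)
    rw [← hQ] at this
    simpa [hx, hq] using this
  obtain ⟨m, hm1, h3⟩ : ∃ m ≤ 1, HasSum (fun k => x k * (k : ℝ)) m := by
    refine ⟨_, ?_, by simpa using toReal hmean⟩
    exact ENNReal.toReal_le_of_le_ofReal zero_le_one (by simpa using hmean)
  -- The gap between `q ^ k` and its tangent at `1`: its terms are nonnegative by Bernoulli, while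
  -- the sum is at most `0` as `m ≤ 1`. So all terms vanish, which kills `x k` for `k ≥ 2`.
  have h4 : HasSum (fun k => x k * (q ^ k - (1 - k * (1 - q)))) (q - 1 + m * (1 - q)) := by
    have h : (fun k => x k * q ^ k - x k + x k * k * (1 - q)) =
        fun k => x k * (q ^ k - (1 - k * (1 - q))) := by
      funext k
      ring
    exact h ▸ (h2.sub h1).add (h3.mul_right (1 - q))
  have hpos (k : ℕ) : 0 ≤ q ^ k - (1 - k * (1 - q)) := by
    rcases Nat.lt_or_ge k 2 with h | h
    · interval_cases k <;> simp
    · linarith [one_sub_mul_one_sub_lt_pow hq0 hq1 h]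
  have h5 : q - 1 + m * (1 - q) = 0 :=
    le_antisymm (by nlinarith) (h4.nonneg fun k => mul_nonneg (hx0 k) (hpos k))
  rw [h5] at h4
  have h6 := (hasSum_zero_iff_of_nonneg fun k => mul_nonneg (hx0 k) (hpos k)).1 h4
  have h7 (k : ℕ) (hk : k ∉ Finset.range 2) : x k = 0 := by
    rw [Finset.mem_range, not_lt] at hk
    have := congrFun h6 k
    rcases mul_eq_zero.1 this with h | h
    · exact h
    · linarith [one_sub_mul_one_sub_lt_pow hq0 hq1 hk]
  have h8 := h1.unique (hasSum_sum_of_ne_finset_zero h7)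
  have h9 := h2.unique (hasSum_sum_of_ne_finset_zero fun k hk => by rw [h7 k hk, zero_mul])
  simp only [Finset.sum_range_succ, Finset.sum_range_zero, pow_zero, pow_one] at h8 h9
  have h10 : x 0 = 0 := by
    have : x 0 * (1 - q) = 0 := by linear_combination q * h8 - h9
    rcases mul_eq_zero.1 this with h | h
    · exact h
    · linarith
  have h11 : (ξ 1).toReal = 1 := by
    change x 1 = 1
    linarith
  exact hξ ((ENNReal.toReal_eq_one_iff _).1 h11)

theorem isProbabilityMeasure_law (ξ : PMF ℕ) (hmean : ∑' k : ℕ, ξ k * (k : ℝ≥0∞) ≤ 1)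
    (hξ : ξ 1 ≠ 1) (η : ∀ k : ℕ, PMF (Fin k → SignType)) : IsProbabilityMeasure (law ξ η) := by
  constructor
  rw [law_apply, Set.indicator_univ]
  refine ξ.eq_one_of_tsum_mul_pow_eq hmean hξ (tsum_weight_le_one ξ η) ?_
  exact tsum_tree ξ η _ _ fun k δ c => by rw [weight]

/-! ### Reflection of the labels -/

section Reflection

/-- The tree with all increments negated. -/
def reflect : LabelledPlaneTree → LabelledPlaneTree
  | node k δ c => node k (fun i => -δ i) fun i => reflect (c i)

theorem reflect_involutive : Function.Involutive reflect := by
  intro t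
  induction t with
  | node k δ c ih => simp [reflect, ih]

theorem edgeCount_reflect (a b : ℤ) (t : LabelledPlaneTree) (x : ℤ) :
    edgeCount a b x (reflect t) = edgeCount (-a) (-b) (-x) t := by
  induction t generalizing x with
  | node k δ c ih =>
    rw [reflect, edgeCount, edgeCount]
    refine Finset.sum_congr rfl fun i _ => ?_
    have h : x + ((-δ i : SignType) : ℤ) = -(-x + (δ i : ℤ)) := by
      rw [SignType.coe_neg]
      ring
    rw [ih, h, neg_neg]
    congr 2
    rw [neg_inj, neg_eq_iff_eq_neg]

theorem posProcess_reflect (t : LabelledPlaneTree) : posProcess (reflect t) = negProcess t := by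
  funext j
  simp only [posProcess, negProcess, Xplus, Xminus, XcheckPlus, XcheckMinus, edgeCount_reflect,
    neg_sub, neg_zero, Prod.mk.injEq]
  rw [show (1 : ℤ) - ((j + 1 : ℕ) : ℤ) = -((j + 1 : ℕ) : ℤ) + 1 by ring]
  exact ⟨rfl, rfl⟩

/-- The displacement laws of the reflected trees. -/
noncomputable def reflectDisplacements (η : ∀ k : ℕ, PMF (Fin k → SignType)) (k : ℕ) :
    PMF (Fin k → SignType) :=
  (η k).map fun δ i => -δ i

theorem reflectDisplacements_neg (η : ∀ k : ℕ, PMF (Fin k → SignType)) (k : ℕ)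
    (δ : Fin k → SignType) : reflectDisplacements η k (fun i => -δ i) = η k δ := by
  rw [reflectDisplacements, PMF.map_apply, tsum_eq_single δ]
  · simp
  · intro δ' hne
    rw [if_neg]
    intro h
    refine hne (funext fun i => ?_)
    simpa using (congrFun h i).symm

variable (ξ : PMF ℕ) (η : ∀ k : ℕ, PMF (Fin k → SignType))

theorem weight_reflect (t : LabelledPlaneTree) :
    weight ξ (reflectDisplacements η) (reflect t) = weight ξ η t := by
  induction t with
  | node k δ c ih => simp only [reflect, weight, reflectDisplacements_neg, ih]

theorem law_preimage_reflect (A : Set LabelledPlaneTree) :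
    law ξ η (reflect ⁻¹' A) = law ξ (reflectDisplacements η) A := by
  rw [law_apply, law_apply,
    ← reflect_involutive.toPerm.tsum_eq (A.indicator (weight ξ (reflectDisplacements η)))]
  congr 1
  funext t
  change _ = A.indicator (weight ξ (reflectDisplacements η)) (reflect t)
  by_cases h : reflect t ∈ A
  · rw [Set.indicator_of_mem h, Set.indicator_of_mem (show t ∈ reflect ⁻¹' A from h),
      weight_reflect]
  · rw [Set.indicator_of_notMem h, Set.indicator_of_notMem (show t ∉ reflect ⁻¹' A from h)]

end Reflection

end LabelledPlaneTree

/-! ### Edge counts and their joint law -/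

namespace LabelledPlaneTree

/-- The numbers of edges of all types, when the root has label `x`. -/
noncomputable def edges : ℤ → LabelledPlaneTree → (ℤ × SignType →₀ ℕ)
  | x, node _ δ c => ∑ i, (Finsupp.single (x, δ i) 1 + edges (x + (δ i : ℤ)) (c i))

theorem edgeCount_eq_edges (a : ℤ) (ε : SignType) (t : LabelledPlaneTree) (x : ℤ) :
    edgeCount a (a + (ε : ℤ)) x t = edges x t (a, ε) := by
  induction t generalizing x with
  | node k δ c ih =>
    rw [edgeCount, edges, Finsupp.finsetSum_apply]
    refine Finset.sum_congr rfl fun i _ => ?_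
    rw [ih, Finsupp.add_apply, Finsupp.single_apply]
    congr 1
    have hinj (ε ε' : SignType) (h : (ε : ℤ) = ε') : ε = ε' := by
      cases ε <;> cases ε' <;> simp at h ⊢
    refine if_congr ?_ rfl rfl
    rw [Prod.mk.injEq]
    constructor
    · rintro ⟨rfl, h⟩
      exact ⟨rfl, hinj _ _ (by simpa using h)⟩
    · rintro ⟨rfl, rfl⟩
      exact ⟨rfl, rfl⟩

theorem edgeCount_add (r a b : ℤ) (t : LabelledPlaneTree) (x : ℤ) :
    edgeCount (a + r) (b + r) (x + r) t = edgeCount a b x t := by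
  induction t generalizing x with
  | node k δ c ih =>
    rw [edgeCount, edgeCount]
    refine Finset.sum_congr rfl fun i _ => ?_
    rw [add_right_comm, ih]
    simp only [add_left_inj]

/-- Giving the root label `-m` moves the entry of index `m` to the edges between `0` and `1`. -/
theorem posProcess_eq_edges (m : ℕ) (t : LabelledPlaneTree) (j : ℕ) :
    posProcess t j = (edges (-m) t ((j : ℤ) - m, 1), edges (-m) t ((j : ℤ) + 1 - m, -1)) := by
  rw [← edgeCount_eq_edges, ← edgeCount_eq_edges, posProcess, Xplus, Xminus,
    ← edgeCount_add (-m) _ _ _ 0, ← edgeCount_add (-m) _ _ _ 0]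
  push_cast
  congr 2 <;> simp <;> ring

theorem negProcess_eq_edges (t : LabelledPlaneTree) (j : ℕ) :
    negProcess t j = (edges 0 t (-(j : ℤ), -1), edges 0 t (-((j : ℤ) + 1), 1)) := by
  rw [← edgeCount_eq_edges, ← edgeCount_eq_edges, negProcess, XcheckMinus, XcheckPlus]
  simp only [SignType.coe_neg_one, SignType.coe_one]
  push_cast
  congr 2
  all_goals ring

open MvPowerSeries (X C coeff)

section Law

variable (ξ : PMF ℕ) (η : ∀ k : ℕ, PMF (Fin k → SignType))

/-- The weight of a vertex. -/
noncomputable def vertexWeight (k : ℕ) (δ : Fin k → SignType) : ℝ≥0∞ := ξ k * η k δ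

theorem term_eq_monomial (t : LabelledPlaneTree) (x : ℤ) :
    term (fun y ε => (X (y, ε) : EdgeSeries)) (fun _ k δ => C (vertexWeight ξ η k δ)) x t =
      MvPowerSeries.monomial (edges x t) (weight ξ η t) := by
  induction t generalizing x with
  | node k δ c ih =>
    have h (i : Fin k) : (X (x, δ i) * MvPowerSeries.monomial (edges (x + (δ i : ℤ)) (c i))
        (weight ξ η (c i)) : EdgeSeries) = MvPowerSeries.monomial
        (Finsupp.single (x, δ i) 1 + edges (x + (δ i : ℤ)) (c i)) (weight ξ η (c i)) := by
      rw [X, MvPowerSeries.monomial_mul_monomial, one_mul]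
    simp only [term, weight, edges, ih, h]
    rw [MvPowerSeries.prod_monomial, ← MvPowerSeries.monomial_zero_eq_C_apply,
      MvPowerSeries.monomial_mul_monomial, zero_add]
    rfl

theorem law_edges (x : ℤ) (A : Set (ℤ × SignType →₀ ℕ)) :
    law ξ η {t | edges x t ∈ A} = ∑' s, A.indicator (coeff · (edgeGf (vertexWeight ξ η) x)) s := by
  classical
  rw [law_apply]
  have h (s : ℤ × SignType →₀ ℕ) : A.indicator (coeff · (edgeGf (vertexWeight ξ η) x)) s =
      ∑' t, if s = edges x t then {t | edges x t ∈ A}.indicator (weight ξ η) t else 0 := by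
    by_cases hs : s ∈ A
    · rw [Set.indicator_of_mem hs, edgeGf, gf, mvPowerSeries_coeff_S, ennreal_S]
      congr 1
      funext t
      rw [term_eq_monomial, MvPowerSeries.coeff_monomial]
      split_ifs with h
      · rw [Set.indicator_of_mem]
        rwa [h] at hs
      · rfl
    · rw [Set.indicator_of_notMem hs, eq_comm, ENNReal.tsum_eq_zero]
      intro t
      split_ifs with h
      · rw [Set.indicator_of_notMem]
        exact fun h' => hs (h ▸ h')
      · rfl
  simp only [h]
  rw [ENNReal.tsum_comm]
  congr 1
  funext t
  rw [tsum_ite_eq]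

/-- The mass of the lower parts in a set of edge counts. -/
noncomputable def lowerMass (x : ℤ) (n d : ℕ) (A : Set (ℤ × SignType →₀ ℕ)) : ℝ≥0∞ :=
  ∑' a, A.indicator (coeff · (lowerPart (vertexWeight ξ η) x n d)) a

/-- The mass of the upper parts in a set of edge counts. -/
noncomputable def upperMass (n d : ℕ) (A : Set (ℤ × SignType →₀ ℕ)) : ℝ≥0∞ :=
  ∑' a, A.indicator (coeff · (upperPart (vertexWeight ξ η) n d)) a

open scoped Classical in
/-- The edges below and above are independent, given the numbers of edges between `0` and `1`. -/
theorem law_edges_split {x : ℤ} (hx : x ≤ 0) (n d : ℕ) (A B : Set (ℤ × SignType →₀ ℕ)) :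
    law ξ η {t | edges x t upEdge = n ∧ edges x t downEdge = d ∧
      (edges x t).filter (· ∈ lowerEdges) ∈ A ∧ (edges x t).filter (· ∈ upperEdges) ∈ B} =
    lowerMass ξ η x n d A * upperMass ξ η n d B := by
  set E : Set (ℤ × SignType →₀ ℕ) := {s | s upEdge = n ∧ s downEdge = d ∧
    s.filter (· ∈ lowerEdges) ∈ A ∧ s.filter (· ∈ upperEdges) ∈ B} with hE
  rw [show {t | edges x t upEdge = n ∧ edges x t downEdge = d ∧
      (edges x t).filter (· ∈ lowerEdges) ∈ A ∧ (edges x t).filter (· ∈ upperEdges) ∈ B} =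
      {t | edges x t ∈ E} from rfl, law_edges, lowerMass, upperMass, ← ENNReal.tsum_mul_right]
  simp only [← ENNReal.tsum_mul_left]
  rw [← ENNReal.tsum_prod (f := fun a b =>
    A.indicator (coeff · (lowerPart (vertexWeight ξ η) x n d)) a *
      B.indicator (coeff · (upperPart (vertexWeight ξ η) n d)) b)]
  symm
  have hval (s : ℤ × SignType →₀ ℕ) (hs : s ∈ E) :
      A.indicator (coeff · (lowerPart (vertexWeight ξ η) x n d)) (s.filter (· ∈ lowerEdges)) *
      B.indicator (coeff · (upperPart (vertexWeight ξ η) n d)) (s.filter (· ∈ upperEdges)) =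
      E.indicator (coeff · (edgeGf (vertexWeight ξ η) x)) s := by
    obtain ⟨h1, h2, h3, h4⟩ := id hs
    rw [Set.indicator_of_mem h3, Set.indicator_of_mem h4, Set.indicator_of_mem hs,
      coeff_edgeGf _ hx, h1, h2]
  -- On `E`, where the crossing counts are `n` and `d`, edge counts correspond to pairs of lower and
  -- upper counts; the inverse adds back the two crossing types.
  refine tsum_eq_tsum_of_ne_zero_bij
    (fun s => ((s : ℤ × SignType →₀ ℕ).filter (· ∈ lowerEdges),
      (s : ℤ × SignType →₀ ℕ).filter (· ∈ upperEdges))) ?_ ?_ ?_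
  · rintro ⟨s, hs⟩ ⟨s', hs'⟩ h
    obtain ⟨h1, h2, -⟩ := Set.mem_of_indicator_ne_zero hs
    obtain ⟨h1', h2', -⟩ := Set.mem_of_indicator_ne_zero hs'
    obtain ⟨hl, hu⟩ := Prod.ext_iff.1 h
    refine Subtype.ext (Finsupp.ext fun e => ?_)
    by_cases he : e ∈ lowerEdges
    · simpa [he] using DFunLike.congr_fun hl e
    by_cases he' : e ∈ upperEdges
    · simpa [he'] using DFunLike.congr_fun hu e
    rcases eq_upEdge_or_eq_downEdge he he' with rfl | rfl
    exacts [h1.trans h1'.symm, h2.trans h2'.symm]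
  · rintro ⟨a, b⟩ hab
    have ha := left_ne_zero_of_mul (Function.mem_support.1 hab)
    have hb := right_ne_zero_of_mul (Function.mem_support.1 hab)
    have haA := Set.mem_of_indicator_ne_zero ha
    have hbB := Set.mem_of_indicator_ne_zero hb
    simp only [Set.indicator_of_mem haA, Set.indicator_of_mem hbB] at ha hb
    have hal := lowerPart_mem _ x n d a ha
    have hbu := upperPart_mem _ n d b hb
    have hal' (e) (he : e ∉ lowerEdges) : a e = 0 := by
      by_contra h
      exact he (hal e h)
    have hbu' (e) (he : e ∉ upperEdges) : b e = 0 := by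
      by_contra h
      exact he (hbu e h)
    have hne : upEdge ≠ downEdge := by simp [upEdge, downEdge]
    set s : ℤ × SignType →₀ ℕ := a + b + Finsupp.single upEdge n + Finsupp.single downEdge d
      with hs
    have hsl : s.filter (· ∈ lowerEdges) = a := by
      ext e
      by_cases he : e ∈ lowerEdges
      · have h1 : upEdge ≠ e := fun h => upEdge_notMem_lowerEdges (h ▸ he)
        have h2 : downEdge ≠ e := fun h => downEdge_notMem_lowerEdges (h ▸ he)
        have h3 : b e = 0 := hbu' e fun h => upperEdges_subset h he
        simp [he, hs, h3, h1, h2]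
      · simp [he, hal' e he]
    have hsu : s.filter (· ∈ upperEdges) = b := by
      ext e
      by_cases he : e ∈ upperEdges
      · have h1 : upEdge ≠ e := fun h => upEdge_notMem_upperEdges (h ▸ he)
        have h2 : downEdge ≠ e := fun h => downEdge_notMem_upperEdges (h ▸ he)
        have h3 : a e = 0 := hal' e (upperEdges_subset he)
        simp [he, hs, h3, h1, h2]
      · simp [he, hbu' e he]
    have hsE : s ∈ E := by
      refine ⟨?_, ?_, by rwa [hsl], by rwa [hsu]⟩
      · simp [hs, hal' _ upEdge_notMem_lowerEdges, hbu' _ upEdge_notMem_upperEdges, hne]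
      · simp [hs, hal' _ downEdge_notMem_lowerEdges, hbu' _ downEdge_notMem_upperEdges, hne]
    refine ⟨⟨s, ?_⟩, ?_⟩
    · rw [Function.mem_support, ← hval s hsE, hsl, hsu]
      exact Function.mem_support.1 hab
    · simp only [hsl, hsu]
  · rintro ⟨s, hs⟩
    exact hval s (Set.mem_of_indicator_ne_zero hs)

/-! ### The Markov property -/

/-- The law of the numbers of edges between `1` and `2` under the upper mass, not normalized. -/
noncomputable def nextMass (y y' : ℕ × ℕ) : ℝ≥0∞ :=
  upperMass ξ η y.1 y.2 {b | (b (1, 1), b (2, -1)) = y'}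

theorem tsum_nextMass (y : ℕ × ℕ) : ∑' y', nextMass ξ η y y' = upperMass ξ η y.1 y.2 Set.univ := by
  classical
  simp only [nextMass, upperMass]
  rw [ENNReal.tsum_comm]
  congr 1
  funext b
  rw [Set.indicator_univ, ← tsum_ite_eq (b (1, 1), b (2, -1))
    fun _ => coeff b (upperPart (vertexWeight ξ η) y.1 y.2)]
  congr 1
  funext y'
  by_cases h : (b (1, 1), b (2, -1)) = y'
  · rw [Set.indicator_of_mem (by exact h), if_pos h.symm]
  · rw [Set.indicator_of_notMem (by exact h), if_neg (Ne.symm h)]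

open scoped Classical in
/-- The transition kernel of the process of positive levels. -/
noncomputable def transition (y : ℕ × ℕ) : PMF (ℕ × ℕ) :=
  if h : (∑' y', nextMass ξ η y y') ≠ 0 ∧ (∑' y', nextMass ξ η y y') ≠ ∞ then
    PMF.normalize (nextMass ξ η y) h.1 h.2
  -- An arbitrary value: at such a state both sides of the Markov identity vanish.
  else PMF.pure y

-- Root label `-n` puts the present on the crossing edges, the past on lower edges and the next
-- state on upper ones. The second factor depends on `n` only through `y n`.
open scoped Classical in
theorem law_posProcess_split (n : ℕ) (y : ℕ → ℕ × ℕ) (B : Set (ℕ × ℕ)) :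
    law ξ η {t | (∀ i ≤ n, posProcess t i = y i) ∧ posProcess t (n + 1) ∈ B} =
      lowerMass ξ η (-n) (y n).1 (y n).2
        {a | ∀ i < n, (a ((i : ℤ) - n, 1), a ((i : ℤ) + 1 - n, -1)) = y i} *
      upperMass ξ η (y n).1 (y n).2 {b | (b (1, 1), b (2, -1)) ∈ B} := by
  rw [← law_edges_split ξ η (show -(n : ℤ) ≤ 0 by omega)]
  congr 1
  ext t
  have h1 (i : ℕ) (hi : i < n) : ((i : ℤ) - n, (1 : SignType)) ∈ lowerEdges := by
    simp only [lowerEdges, Set.mem_ofPred_eq, SignType.coe_one]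
    omega
  have h2 (i : ℕ) (hi : i < n) : ((i : ℤ) + 1 - n, (-1 : SignType)) ∈ lowerEdges := by
    simp only [lowerEdges, Set.mem_ofPred_eq, SignType.coe_neg_one]
    omega
  have h3 : ((1 : ℤ), (1 : SignType)) ∈ upperEdges := by simp [upperEdges]
  have h4 : ((2 : ℤ), (-1 : SignType)) ∈ upperEdges := by simp [upperEdges]
  have h5 : posProcess t (n + 1) =
      (edges (-n) t (1, 1), edges (-n) t (2, -1)) := by
    rw [posProcess_eq_edges n]
    push_cast
    congr 4 <;> ring
  have h6 : posProcess t n = (edges (-n) t upEdge, edges (-n) t downEdge) := by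
    rw [posProcess_eq_edges n, upEdge, downEdge]
    congr 4 <;> ring
  have h7 : (∀ i ≤ n, posProcess t i = y i) ↔
      posProcess t n = y n ∧ ∀ i < n, posProcess t i = y i := by
    constructor
    · exact fun h => ⟨h n le_rfl, fun i hi => h i hi.le⟩
    · rintro ⟨h, h'⟩ i hi
      rcases hi.lt_or_eq with hi | rfl
      exacts [h' i hi, h]
  have h8 : (∀ i < n, posProcess t i = y i) ↔ (edges (-n) t).filter (· ∈ lowerEdges) ∈
      {a : ℤ × SignType →₀ ℕ | ∀ i < n, (a ((i : ℤ) - n, 1), a ((i : ℤ) + 1 - n, -1)) = y i} := by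
    rw [Set.mem_ofPred_eq]
    refine forall₂_congr fun i hi => ?_
    rw [posProcess_eq_edges n, Finsupp.filter_apply_pos _ _ (h1 i hi),
      Finsupp.filter_apply_pos _ _ (h2 i hi)]
  have h9 : posProcess t (n + 1) ∈ B ↔ (edges (-n) t).filter (· ∈ upperEdges) ∈
      {b : ℤ × SignType →₀ ℕ | (b (1, 1), b (2, -1)) ∈ B} := by
    rw [Set.mem_ofPred_eq, h5, Finsupp.filter_apply_pos _ _ h3, Finsupp.filter_apply_pos _ _ h4]
  simp only [Set.mem_ofPred_eq] at h8 h9 ⊢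
  rw [h7, h8, h9, h6, Prod.ext_iff]
  tauto

theorem isTimeHomogeneousMarkovChain_posProcess [IsFiniteMeasure (law ξ η)] :
    IsTimeHomogeneousMarkovChain (law ξ η) posProcess := by
  refine ⟨transition ξ η, fun n y => ?_⟩
  have h1 := law_posProcess_split ξ η n y Set.univ
  have h2 := law_posProcess_split ξ η n y {y (n + 1)}
  have h3 : {t | ∀ i ≤ n + 1, posProcess t i = y i} =
      {t | (∀ i ≤ n, posProcess t i = y i) ∧ posProcess t (n + 1) ∈ ({y (n + 1)} : Set _)} := by
    ext t
    simp only [Set.mem_ofPred_eq, Set.mem_singleton_iff]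
    constructor
    · exact fun h => ⟨fun i hi => h i (by omega), h _ le_rfl⟩
    · rintro ⟨h, h'⟩ i hi
      rcases Nat.le_succ_iff.1 hi with hi | rfl
      exacts [h i hi, h']
  simp only [Set.mem_univ, and_true, Set.ofPred_true] at h1
  set a := lowerMass ξ η (-n) (y n).1 (y n).2
    {a | ∀ i < n, (a ((i : ℤ) - n, 1), a ((i : ℤ) + 1 - n, -1)) = y i}
  have hfin : a * upperMass ξ η (y n).1 (y n).2 Set.univ ≠ ∞ := h1 ▸ measure_ne_top _ _
  have hnext : upperMass ξ η (y n).1 (y n).2 {b | (b (1, 1), b (2, -1)) ∈ ({y (n + 1)} : Set _)} =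
      nextMass ξ η (y n) (y (n + 1)) := rfl
  rw [h3, h2, h1, hnext, ← tsum_nextMass] at *
  by_cases h : (∑' y', nextMass ξ η (y n) y') ≠ 0 ∧ (∑' y', nextMass ξ η (y n) y') ≠ ∞
  · rw [transition, dif_pos h, PMF.normalize_apply, mul_assoc, mul_left_comm (∑' y', _),
      ENNReal.mul_inv_cancel h.1 h.2, mul_one]
  rw [not_and_or, not_not, not_not] at h
  rcases h with h | h
  · have : nextMass ξ η (y n) (y (n + 1)) = 0 := ENNReal.tsum_eq_zero.1 h _
    rw [this, h, mul_zero, zero_mul]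
  -- Infinite upper mass forces zero lower mass, since their product is a probability of the past
  -- under a finite measure.
  · have : a = 0 := by
      by_contra ha
      exact hfin (by rw [h, ENNReal.mul_top ha])
    rw [this, zero_mul, zero_mul, zero_mul]

theorem isTimeHomogeneousMarkovChain_negProcess
    [IsFiniteMeasure (law ξ (reflectDisplacements η))] :
    IsTimeHomogeneousMarkovChain (law ξ η) negProcess := by
  obtain ⟨K, hK⟩ := isTimeHomogeneousMarkovChain_posProcess ξ (reflectDisplacements η)
  have h (n : ℕ) (y : ℕ → ℕ × ℕ) : law ξ η {t | ∀ i ≤ n, negProcess t i = y i} =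
      law ξ (reflectDisplacements η) {t | ∀ i ≤ n, posProcess t i = y i} := by
    rw [← law_preimage_reflect]
    simp only [Set.preimage_ofPred_eq, posProcess_reflect]
  exact ⟨K, fun n y => by rw [h, h, hK]⟩

theorem identDistrib_negProcess_posProcess (hη : SymmetricDisplacements η) :
    IdentDistrib negProcess posProcess (law ξ η) (law ξ η) := by
  have hm (f : LabelledPlaneTree → ℕ → ℕ × ℕ) : Measurable f := fun _ _ =>
    MeasurableSpace.measurableSet_top
  refine ⟨(hm _).aemeasurable, (hm _).aemeasurable, Measure.ext fun A hA => ?_⟩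
  have h : reflectDisplacements η = η := funext hη
  rw [Measure.map_apply (hm _) hA, Measure.map_apply (hm _) hA]
  conv_rhs => rw [← h, ← law_preimage_reflect, ← Set.preimage_comp]
  congr 2
  funext t
  exact (posProcess_reflect t).symm

/-! ### Conditional independence -/

-- The root keeps label `0`. The entry of `posProcess` at index `0` lies on the crossing edges and
-- is thus fixed to `x`; its other entries are upper, and all of `negProcess` is lower.
open scoped Classical in
theorem law_negProcess_posProcess (x : ℕ × ℕ) (A B : Set (ℕ → ℕ × ℕ)) :
    law ξ η {t | posProcess t 0 = x ∧ negProcess t ∈ A ∧ posProcess t ∈ B} =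
      lowerMass ξ η 0 x.1 x.2 {a | (fun j : ℕ => (a (-(j : ℤ), -1), a (-((j : ℤ) + 1), 1))) ∈ A} *
      upperMass ξ η x.1 x.2 {b | (fun j : ℕ => if j = 0 then x else
        (b ((j : ℤ), 1), b ((j : ℤ) + 1, -1))) ∈ B} := by
  rw [← law_edges_split ξ η le_rfl]
  congr 1
  ext t
  have h0 (j : ℕ) : posProcess t j =
      (edges 0 t ((j : ℤ), 1), edges 0 t ((j : ℤ) + 1, -1)) := by
    simpa using posProcess_eq_edges 0 t j
  have h1 : posProcess t 0 = x ↔ edges 0 t upEdge = x.1 ∧ edges 0 t downEdge = x.2 := by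
    rw [h0, Prod.ext_iff]
    simp [upEdge, downEdge]
  have h2 : negProcess t = fun j : ℕ => ((edges 0 t).filter (· ∈ lowerEdges) (-(j : ℤ), -1),
      (edges 0 t).filter (· ∈ lowerEdges) (-((j : ℤ) + 1), 1)) := by
    funext j
    rw [negProcess_eq_edges, Finsupp.filter_apply_pos, Finsupp.filter_apply_pos] <;>
    · simp only [lowerEdges, Set.mem_ofPred_eq, SignType.coe_one, SignType.coe_neg_one]
      omega
  have h3 (h : posProcess t 0 = x) : posProcess t = fun j : ℕ => if j = 0 then x else
      ((edges 0 t).filter (· ∈ upperEdges) ((j : ℤ), 1),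
      (edges 0 t).filter (· ∈ upperEdges) ((j : ℤ) + 1, -1)) := by
    funext j
    rcases Nat.eq_zero_or_pos j with rfl | hj
    · rw [h, if_pos rfl]
    · rw [if_neg hj.ne', h0, Finsupp.filter_apply_pos, Finsupp.filter_apply_pos] <;>
      · simp only [upperEdges, Set.mem_ofPred_eq, SignType.coe_one, SignType.coe_neg_one]
        omega
  simp only [Set.mem_ofPred_eq]
  rw [← and_assoc (a := edges 0 t upEdge = x.1), ← h1, ← h2]
  exact and_congr_right fun h => by rw [← h3 h]

theorem indepFun_cond [IsFiniteMeasure (law ξ η)] (x : ℕ × ℕ) :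
    IndepFun negProcess posProcess (cond (law ξ η) {t | (Xplus 1 t, Xminus 1 t) = x}) := by
  rw [indepFun_iff_measure_inter_preimage_eq_mul]
  intro A B _ _
  have hE : {t | (Xplus 1 t, Xminus 1 t) = x} = {t | posProcess t 0 = x} := rfl
  rw [hE]
  simp only [cond_apply (MeasurableSpace.measurableSet_top : MeasurableSet {t | posProcess t 0 = x})]
  have h1 := law_negProcess_posProcess ξ η x A B
  have h2 := law_negProcess_posProcess ξ η x A Set.univ
  have h3 := law_negProcess_posProcess ξ η x Set.univ B
  have h4 := law_negProcess_posProcess ξ η x Set.univ Set.univ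
  simp only [Set.mem_univ, and_true, true_and] at h2 h3 h4
  set a := lowerMass ξ η 0 x.1 x.2
    {a | (fun j : ℕ => (a (-(j : ℤ), -1), a (-((j : ℤ) + 1), 1))) ∈ A}
  set b := upperMass ξ η x.1 x.2
    {b | (fun j : ℕ => if j = 0 then x else (b ((j : ℤ), 1), b ((j : ℤ) + 1, -1))) ∈ B}
  set a' := lowerMass ξ η 0 x.1 x.2 {_a | True}
  set b' := upperMass ξ η x.1 x.2 {_b | True}
  have hne := measure_ne_top (law ξ η) {t | posProcess t 0 = x}
  rw [show {t | posProcess t 0 = x} ∩ (negProcess ⁻¹' A ∩ posProcess ⁻¹' B) =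
      {t | posProcess t 0 = x ∧ negProcess t ∈ A ∧ posProcess t ∈ B} from rfl,
    show {t | posProcess t 0 = x} ∩ negProcess ⁻¹' A =
      {t | posProcess t 0 = x ∧ negProcess t ∈ A} from rfl,
    show {t | posProcess t 0 = x} ∩ posProcess ⁻¹' B =
      {t | posProcess t 0 = x ∧ posProcess t ∈ B} from rfl, h1, h2, h3, h4]
  rw [h4] at hne
  -- `a' * b'` is the mass of the conditioning event. If it is null, the inverse is `∞`, but all the
  -- masses it multiplies are `0`.
  by_cases h0 : a' * b' = 0
  · have ha : a ≤ a' := ENNReal.tsum_le_tsum fun s =>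
      Set.indicator_le_indicator_of_subset (fun _ _ => trivial) (fun _ => zero_le) s
    have hb : b ≤ b' := ENNReal.tsum_le_tsum fun s =>
      Set.indicator_le_indicator_of_subset (fun _ _ => trivial) (fun _ => zero_le) s
    have hz : ∀ u ≤ a', ∀ v ≤ b', u * v = 0 := fun u hu v hv =>
      le_antisymm (h0 ▸ mul_le_mul' hu hv) (zero_le)
    rw [hz a ha b hb, hz a ha b' le_rfl, mul_zero, zero_mul]
  · calc (a' * b')⁻¹ * (a * b) = (a' * b')⁻¹ * (a * b) * ((a' * b')⁻¹ * (a' * b')) := by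
          rw [ENNReal.inv_mul_cancel h0 hne, mul_one]
      _ = (a' * b')⁻¹ * (a * b') * ((a' * b')⁻¹ * (a' * b)) := by ring

end Law

end LabelledPlaneTree

open LabelledPlaneTree in
theorem corollary4p3 (ξ : PMF ℕ) (hmean : ∑' k : ℕ, ξ k * (k : ℝ≥0∞) ≤ 1) (hξ : ξ 1 ≠ 1)
    (η : ∀ k : ℕ, PMF (Fin k → SignType)) :
    -- the weights define a probability measure on finite labelled trees
    IsProbabilityMeasure (law ξ η) ∧
    -- both processes are time-homogeneous Markov chains
    IsTimeHomogeneousMarkovChain (law ξ η) negProcess ∧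
    IsTimeHomogeneousMarkovChain (law ξ η) posProcess ∧
    -- they have the same law if the displacement laws are symmetric
    (SymmetricDisplacements η → IdentDistrib negProcess posProcess (law ξ η) (law ξ η)) ∧
    -- they are independent conditionally on the value of the pair at level one
    ∀ x : ℕ × ℕ,
      IndepFun negProcess posProcess (cond (law ξ η) {t | (Xplus 1 t, Xminus 1 t) = x}) := by
  have := isProbabilityMeasure_law ξ hmean hξ
  exact ⟨this η, isTimeHomogeneousMarkovChain_negProcess ξ η,
    isTimeHomogeneousMarkovChain_posProcess ξ η, identDistrib_negProcess_posProcess ξ η,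
    indepFun_cond ξ η⟩
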